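/- Let $(X,\mathcal F,\mu)$ be a $\sigma$-finite measure space and let $\mathcal A\subseteq\mathcal F$ be a $\sigma$-subalgebra such that $(X,\mathcal A,\mu|_{\mathcal A})$ is $\sigma$-finite; functions are identified when they agree almost everywhere. Let $E$ be the conditional expectation relative to $\mathcal A$, defined for all nonnegative measurable functions (with values in $[0,\infty]$) and, by $E(f)=E(f^+)-E(f^-)$ on real and imaginary parts, for all measurable $f:X\to\mathbb C$ that are conditionable, i.e. satisfy $E(|f|)<\infty$ a.e. For measurable $w,u:X\to\mathbb C$, say that $M_wEM_u$ is a bounded operator on $L^2(\mathcal F)=L^2(X,\mathcal F,\mu;\mathbb C)$ if for every $f\in L^2(\mathcal F)$ the function $uf$ is conditionable and $wE(uf)\in L^2(\mathcal F)$, and the map $f\mapsto wE(uf)$ is bounded on $L^2(\mathcal F)$. For a bounded operator $T$ on a complex Hilbert space $\mathcal H$ with spectral radius $r(T)$, and for each integer $m\ge1$, put $$d_m=\frac1{1/m+r(T)},\qquad R_m=\Big(\sum_{n=0}^\infty d_m^{2n}\,T^{*n}T^n\Big)^{1/2},$$ where the series converges in norm and $R_m$ is positive and invertible. The spectral radius algebra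 of $T$ is $$\mathcal B_T=\Big\{S\in\mathcal B(\mathcal H):\ \sup_{m\ge1}\|R_mSR_m^{-1}\|<\infty\Big\}.$$ Proposition. Let $w,u:X\to\mathbb C$ be conditionable, assume that $E(|u|^2)\in L^\infty(\mathcal A)$, and assume that $M_wEM_u$ is a bounded operator on $L^2(\mathcal F)$. If $a:X\to\mathbb R$ is $\mathcal A$-measurable with $a\ge0$, and $M_{a\bar u}EM_u$ is a bounded operator on $L^2(\mathcal F)$, then $$M_{a\bar u}EM_u\in\mathcal B_{M_wEM_u}.$$ -/

import Mathlib

open MeasureTheory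
open scoped ENNReal NNReal ComplexConjugate

noncomputable section

namespace SpectralRadiusAlgebra

variable {H : Type*} [NormedAddCommGroup H] [InnerProductSpace ℂ H] [CompleteSpace H]

/-- The number `d_m = 1 / (1/m + r(T))`, with `r(T)` the spectral radius of `T` (it is used for
`m ≥ 1` only). The spectral radius of a bounded operator is finite, so `toReal` loses nothing. -/
def dCoeff (T : H →L[ℂ] H) (m : ℕ) : ℝ :=
  1 / (1 / (m : ℝ) + (spectralRadius ℂ T).toReal)

/-- `R_m(T) = (∑_{n ≥ 0} d_m^{2n} T*^n T^n)^{1/2}`: the positive square root of the sum of a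
series of positive operators that converges in the operator norm. -/
def R (T : H →L[ℂ] H) (m : ℕ) : H →L[ℂ] H :=
  CFC.sqrt (∑' n : ℕ, (dCoeff T m ^ (2 * n)) • (ContinuousLinearMap.adjoint T ^ n * T ^ n))

/-- The spectral radius algebra `B_T`: all bounded operators `S` with
`sup_{m ≥ 1} ‖R_m S R_m⁻¹‖ < ∞`. (`R_m` is invertible, as `R_m ^ 2 ≥ 1`; `Ring.inverse` is the
inverse in the ring of bounded operators.) -/
def spectralRadiusAlgebra (T : H →L[ℂ] H) : Set (H →L[ℂ] H) :=
  {S | BddAbove ((fun m : ℕ => ‖R T m * S * Ring.inverse (R T m)‖) '' {m | 1 ≤ m})}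

end SpectralRadiusAlgebra

namespace WCE

variable {X : Type*} (𝓐 : MeasurableSpace X) {𝓕 : MeasurableSpace X} (μ : @Measure X 𝓕)

/-- `E(|f|²)`, the conditional expectation of a nonnegative function (values in `[0, ∞]`). -/
def condSq (f : X → ℂ) : X → ℝ≥0∞ :=
  condLExp 𝓐 μ (fun x => ‖f x‖ₑ ^ 2)

/-- `f` is conditionable, i.e. belongs to
`𝓓(E) = {f ∈ L⁰(𝓕) : E(|f|) ∈ L⁰(𝓐)}`: it is measurable and the conditional expectation
of the nonnegative function `|f|` is finite almost everywhere. -/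
def Conditionable (f : X → ℂ) : Prop :=
  AEStronglyMeasurable[𝓕] f μ ∧ ∀ᵐ x ∂μ, condLExp 𝓐 μ (fun x => ‖f x‖ₑ) x < ∞

/-- The conditional expectation of a real function `f`, as `E(f⁺) - E(f⁻)`; meaningful when
`E(|f|) < ∞` almost everywhere. The function `f` need not be integrable. -/
def condReal (f : X → ℝ) : X → ℝ := fun x =>
  (condLExp 𝓐 μ (fun y => ENNReal.ofReal (f y)) x).toReal -
    (condLExp 𝓐 μ (fun y => ENNReal.ofReal (-f y)) x).toReal

/-- The conditional expectation `E(f) = E(Re f) + i E(Im f)` of a conditionable complex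
function. -/
def condE (f : X → ℂ) : X → ℂ := fun x =>
  (condReal 𝓐 μ (fun y => (f y).re) x : ℂ) + Complex.I * (condReal 𝓐 μ (fun y => (f y).im) x : ℂ)

/-- `M_w E M_u` is an everywhere defined bounded operator on `L²(𝓕)`, and equals `T`: for every
`f ∈ L²(𝓕)` the function `u f` is conditionable and `T f = w E(u f)` almost everywhere. -/
def IsWCE (w u : X → ℂ) (T : Lp ℂ 2 μ →L[ℂ] Lp ℂ 2 μ) : Prop :=
  ∀ f : Lp ℂ 2 μ, Conditionable 𝓐 μ (fun x => u x * f x) ∧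
    T f =ᵐ[μ] fun x => w x * condE 𝓐 μ (fun y => u y * f y) x

end WCE

end

/-!
Let `T = M_w E M_u`, `S = M_{aū} E M_u` and `N = a E(|u|²)`. Then `T S = M_N T` and, since
`S* = M_{āū} E M_u`, also `T S* = (M_N)* T`. Testing `S` on the functions `1_B ū` with `B ∈ 𝓐`
shows that `|N| ≤ ‖S‖` almost everywhere, so `M_N` is a bounded multiplication by an `𝓐`-measurable
function; hence `M_N` and `(M_N)*` commute with `T`. It follows that `S` commutes with every
`T*ⁿ Tⁿ`, hence with `R_m`, and `‖R_m S R_m⁻¹‖ ≤ ‖S‖` for all `m`.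
-/

namespace WCE

section ConditionalExpectation

variable {X : Type*} {𝓐 𝓕 : MeasurableSpace X} {μ : @Measure X 𝓕}

theorem trim_withDensity_eq_withDensity_condLExp (h𝓐 : 𝓐 ≤ 𝓕) [SigmaFinite (μ.trim h𝓐)]
    (f : X → ℝ≥0∞) :
    (μ.withDensity f).trim h𝓐 = (μ.trim h𝓐).withDensity (condLExp 𝓐 μ f) := by
  refine @Measure.ext _ 𝓐 _ _ fun s hs => ?_
  rw [trim_measurableSet_eq h𝓐 hs, withDensity_apply _ (h𝓐 s hs), withDensity_apply _ hs,
    setLIntegral_condLExp_trim h𝓐 μ f hs]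

theorem lintegral_mul_condLExp (h𝓐 : 𝓐 ≤ 𝓕) [SigmaFinite (μ.trim h𝓐)] {φ f : X → ℝ≥0∞}
    (hφ : Measurable[𝓐] φ) (hf : AEMeasurable f μ) :
    ∫⁻ x, φ x * condLExp 𝓐 μ f x ∂μ = ∫⁻ x, φ x * f x ∂μ := by
  have hE : Measurable[𝓐] (condLExp 𝓐 μ f) := measurable_condLExp 𝓐 μ f
  calc ∫⁻ x, φ x * condLExp 𝓐 μ f x ∂μ
      = ∫⁻ x, φ x ∂(μ.trim h𝓐).withDensity (condLExp 𝓐 μ f) := by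
        rw [lintegral_withDensity_eq_lintegral_mul _ hE hφ, lintegral_trim h𝓐 (hE.mul hφ)]
        simp only [Pi.mul_apply, mul_comm]
    _ = ∫⁻ x, φ x ∂μ.withDensity f := by
        rw [← trim_withDensity_eq_withDensity_condLExp, lintegral_trim h𝓐 hφ]
    _ = ∫⁻ x, φ x * f x ∂μ := by
        rw [lintegral_withDensity_eq_lintegral_mul₀ hf (hφ.mono h𝓐 le_rfl).aemeasurable]
        simp only [Pi.mul_apply, mul_comm]

theorem condLExp_mul_left (h𝓐 : 𝓐 ≤ 𝓕) [SigmaFinite (μ.trim h𝓐)] {φ f : X → ℝ≥0∞}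
    (hφ : Measurable[𝓐] φ) (hf : AEMeasurable f μ) :
    condLExp 𝓐 μ (fun x => φ x * f x) =ᵐ[μ] fun x => φ x * condLExp 𝓐 μ f x := by
  refine (ae_eq_condLExp h𝓐 μ _ (hφ.mul (measurable_condLExp 𝓐 μ f)) fun s hs => ?_).symm
  have h := lintegral_mul_condLExp h𝓐 (hφ.indicator hs) hf
  simp only [← Set.indicator_mul_left] at h
  rwa [lintegral_indicator (h𝓐 s hs), lintegral_indicator (h𝓐 s hs)] at h

theorem condLExp_add₃ {p q : X → ℝ≥0∞} (hp : AEMeasurable p μ) (hq : AEMeasurable q μ)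
    (r : X → ℝ≥0∞) :
    condLExp 𝓐 μ (fun x => p x + (q x + r x)) =ᵐ[μ]
      fun x => condLExp 𝓐 μ p x + (condLExp 𝓐 μ q x + condLExp 𝓐 μ r x) := by
  filter_upwards [condLExp_add_left (mΩ := 𝓐) (q + r) hp, condLExp_add_left (mΩ := 𝓐) r hq]
    with x hx hx'
  exact hx.trans (congrArg (condLExp 𝓐 μ p x + ·) hx')

theorem condLExp_lt_top_of_le {f g : X → ℝ≥0∞} (hfg : f ≤ᵐ[μ] g)
    (hg : ∀ᵐ x ∂μ, condLExp 𝓐 μ g x < ∞) : ∀ᵐ x ∂μ, condLExp 𝓐 μ f x < ∞ := by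
  filter_upwards [condLExp_mono (mΩ := 𝓐) hfg, hg] with x hle hlt using hle.trans_lt hlt

theorem condLExp_ofReal_lt_top {f : X → ℝ} (hf : ∀ᵐ x ∂μ, condLExp 𝓐 μ (fun y => ‖f y‖ₑ) x < ∞) :
    ∀ᵐ x ∂μ, condLExp 𝓐 μ (fun y => ENNReal.ofReal (f y)) x < ∞ :=
  condLExp_lt_top_of_le (.of_forall fun x => Real.ofReal_le_enorm (f x)) hf

theorem condLExp_ofReal_neg_lt_top {f : X → ℝ}
    (hf : ∀ᵐ x ∂μ, condLExp 𝓐 μ (fun y => ‖f y‖ₑ) x < ∞) :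
    ∀ᵐ x ∂μ, condLExp 𝓐 μ (fun y => ENNReal.ofReal (-f y)) x < ∞ :=
  condLExp_ofReal_lt_top (f := fun y => -f y) (by simpa only [enorm_neg] using hf)

theorem measurable_condReal (f : X → ℝ) : Measurable[𝓐] (condReal 𝓐 μ f) :=
  (measurable_condLExp 𝓐 μ _).ennreal_toReal.sub (measurable_condLExp 𝓐 μ _).ennreal_toReal

theorem condReal_congr {f g : X → ℝ} (h : f =ᵐ[μ] g) : condReal 𝓐 μ f =ᵐ[μ] condReal 𝓐 μ g := by
  filter_upwards [condLExp_congr_ae (mΩ := 𝓐) (h.fun_comp ENNReal.ofReal),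
    condLExp_congr_ae (mΩ := 𝓐) (h.fun_comp fun r => ENNReal.ofReal (-r))] with x hpos hneg
  exact congrArg₂ (fun p q => p.toReal - q.toReal) hpos hneg

theorem condReal_neg (f : X → ℝ) (x : X) :
    condReal 𝓐 μ (fun y => -f y) x = -condReal 𝓐 μ f x := by
  simp [condReal]

theorem condReal_zero (x : X) : condReal 𝓐 μ (fun _ => 0) x = 0 := by
  simp [condReal]

theorem ofReal_add_add_ofReal_neg (a b : ℝ) :
    ENNReal.ofReal (a + b) + (ENNReal.ofReal (-a) + ENNReal.ofReal (-b)) =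
      ENNReal.ofReal (-(a + b)) + (ENNReal.ofReal a + ENNReal.ofReal b) := by
  rw [← ENNReal.toReal_eq_toReal_iff' (by finiteness) (by finiteness)]
  simp only [ENNReal.toReal_add, ENNReal.toReal_ofReal', ENNReal.add_ne_top, ne_eq,
    ENNReal.ofReal_ne_top, not_false_eq_true, and_self]
  linarith [max_zero_sub_max_neg_zero_eq_self a, max_zero_sub_max_neg_zero_eq_self b,
    max_zero_sub_max_neg_zero_eq_self (a + b)]

theorem condReal_add {f g : X → ℝ} (hfm : AEMeasurable f μ) (hgm : AEMeasurable g μ)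
    (hf : ∀ᵐ x ∂μ, condLExp 𝓐 μ (fun y => ‖f y‖ₑ) x < ∞)
    (hg : ∀ᵐ x ∂μ, condLExp 𝓐 μ (fun y => ‖g y‖ₑ) x < ∞) :
    condReal 𝓐 μ (fun x => f x + g x) =ᵐ[μ] fun x => condReal 𝓐 μ f x + condReal 𝓐 μ g x := by
  have hfg : ∀ᵐ x ∂μ, condLExp 𝓐 μ (fun y => ‖f y + g y‖ₑ) x < ∞ := by
    refine condLExp_lt_top_of_le (.of_forall fun x => enorm_add_le (f x) (g x)) ?_
    filter_upwards [condLExp_add_left (mΩ := 𝓐) (fun y => ‖g y‖ₑ) hfm.enorm, hf, hg]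
      with x hadd hfx hgx
    exact hadd.trans_lt (ENNReal.add_lt_top.2 ⟨hfx, hgx⟩)
  have hbalance : ∀ᵐ x ∂μ,
      condLExp 𝓐 μ (fun y => ENNReal.ofReal (f y + g y)) x +
          (condLExp 𝓐 μ (fun y => ENNReal.ofReal (-f y)) x +
            condLExp 𝓐 μ (fun y => ENNReal.ofReal (-g y)) x) =
        condLExp 𝓐 μ (fun y => ENNReal.ofReal (-(f y + g y))) x +
          (condLExp 𝓐 μ (fun y => ENNReal.ofReal (f y)) x +
            condLExp 𝓐 μ (fun y => ENNReal.ofReal (g y)) x) := by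
    filter_upwards [condLExp_add₃ (𝓐 := 𝓐) (hfm.add hgm).ennreal_ofReal hfm.neg.ennreal_ofReal
        fun x => ENNReal.ofReal (-g x),
      condLExp_add₃ (𝓐 := 𝓐) (hfm.add hgm).neg.ennreal_ofReal hfm.ennreal_ofReal
        fun x => ENNReal.ofReal (g x)] with x hleft hright
    simp only [Pi.add_apply, Pi.neg_apply, ofReal_add_add_ofReal_neg] at hleft hright
    exact hleft.symm.trans hright
  filter_upwards [hbalance, condLExp_ofReal_lt_top hf, condLExp_ofReal_neg_lt_top hf,
    condLExp_ofReal_lt_top hg, condLExp_ofReal_neg_lt_top hg, condLExp_ofReal_lt_top hfg,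
    condLExp_ofReal_neg_lt_top hfg] with x hx hfpos hfneg hgpos hgneg hpos hneg
  have hreal := congrArg ENNReal.toReal hx
  rw [ENNReal.toReal_add hpos.ne (ENNReal.add_ne_top.2 ⟨hfneg.ne, hgneg.ne⟩),
    ENNReal.toReal_add hfneg.ne hgneg.ne,
    ENNReal.toReal_add hneg.ne (ENNReal.add_ne_top.2 ⟨hfpos.ne, hgpos.ne⟩),
    ENNReal.toReal_add hfpos.ne hgpos.ne] at hreal
  simp only [condReal]
  linarith

theorem condReal_mul_of_nonneg (h𝓐 : 𝓐 ≤ 𝓕) [SigmaFinite (μ.trim h𝓐)] {φ f : X → ℝ}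
    (hφ : Measurable[𝓐] φ) (hφ0 : ∀ x, 0 ≤ φ x) (hf : AEMeasurable f μ) :
    condReal 𝓐 μ (fun x => φ x * f x) =ᵐ[μ] fun x => φ x * condReal 𝓐 μ f x := by
  filter_upwards [condLExp_mul_left h𝓐 hφ.ennreal_ofReal hf.ennreal_ofReal,
    condLExp_mul_left h𝓐 hφ.ennreal_ofReal hf.neg.ennreal_ofReal] with x hpos hneg
  simp only [Pi.neg_apply, ← ENNReal.ofReal_mul (hφ0 _), mul_neg] at hpos hneg
  simp only [condReal, hpos, hneg, ENNReal.toReal_mul, ENNReal.toReal_ofReal (hφ0 x), mul_sub]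

theorem condReal_ae_eq_condExp {f : X → ℝ} (hf : Integrable f μ) :
    condReal 𝓐 μ f =ᵐ[μ] μ[f|𝓐] := by
  have toReal_ae_eq {g : X → ℝ} (hg : Integrable g μ) :
      (fun x => (condLExp 𝓐 μ (fun y => ENNReal.ofReal (g y)) x).toReal) =ᵐ[μ]
        μ[fun y => (ENNReal.ofReal (g y)).toReal|𝓐] :=
    toReal_condLExp 𝓐 hg.1.aemeasurable.ennreal_ofReal
      ((lintegral_mono fun x => Real.ofReal_le_enorm (g x)).trans_lt hg.2).ne
  have hsub : (fun y => (ENNReal.ofReal (f y)).toReal) - (fun y => (ENNReal.ofReal (-f y)).toReal) =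
      f := by
    ext x
    simp only [Pi.sub_apply, ENNReal.toReal_ofReal', max_zero_sub_max_neg_zero_eq_self]
  have hpos : Integrable (fun y => (ENNReal.ofReal (f y)).toReal) μ := by
    simpa only [ENNReal.toReal_ofReal'] using hf.pos_part
  have hneg : Integrable (fun y => (ENNReal.ofReal (-f y)).toReal) μ := by
    simpa only [ENNReal.toReal_ofReal'] using hf.neg_part
  exact ((toReal_ae_eq hf).sub (toReal_ae_eq hf.neg)).trans
    ((condExp_sub hpos hneg 𝓐).symm.trans (.of_eq (congrArg _ hsub)))

theorem condE_congr {f g : X → ℂ} (h : f =ᵐ[μ] g) : condE 𝓐 μ f =ᵐ[μ] condE 𝓐 μ g := by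
  filter_upwards [condReal_congr (𝓐 := 𝓐) (h.fun_comp Complex.re),
    condReal_congr (𝓐 := 𝓐) (h.fun_comp Complex.im)] with x hre him
  exact congrArg₂ (fun r s : ℝ => (r : ℂ) + Complex.I * s) hre him

theorem measurable_condE (f : X → ℂ) : Measurable[𝓐] (condE 𝓐 μ f) :=
  (Complex.measurable_ofReal.comp (measurable_condReal _)).add
    ((Complex.measurable_ofReal.comp (measurable_condReal _)).const_mul Complex.I)

theorem condE_conj (f : X → ℂ) (x : X) :
    condE 𝓐 μ (fun y => conj (f y)) x = conj (condE 𝓐 μ f x) := by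
  simp only [condE, Complex.conj_re, Complex.conj_im, condReal_neg, map_add, map_mul,
    Complex.conj_ofReal, Complex.conj_I, Complex.ofReal_neg, mul_neg, neg_mul]

theorem condE_neg (f : X → ℂ) (x : X) : condE 𝓐 μ (fun y => -f y) x = -condE 𝓐 μ f x := by
  simp only [condE, Complex.neg_re, Complex.neg_im, condReal_neg, Complex.ofReal_neg]
  ring

theorem condE_I_mul (f : X → ℂ) (x : X) :
    condE 𝓐 μ (fun y => Complex.I * f y) x = Complex.I * condE 𝓐 μ f x := by
  simp only [condE, Complex.I_mul_re, Complex.I_mul_im, condReal_neg, Complex.ofReal_neg]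
  linear_combination (-condReal 𝓐 μ (fun y => (f y).im) x : ℂ) * Complex.I_mul_I

theorem condE_ofReal (f : X → ℝ) (x : X) :
    condE 𝓐 μ (fun y => (f y : ℂ)) x = condReal 𝓐 μ f x := by
  simp only [condE, Complex.ofReal_re, Complex.ofReal_im, condReal_zero, Complex.ofReal_zero,
    mul_zero, add_zero]

theorem Conditionable.condLExp_re_lt_top {f : X → ℂ} (hf : Conditionable 𝓐 μ f) :
    ∀ᵐ x ∂μ, condLExp 𝓐 μ (fun y => ‖(f y).re‖ₑ) x < ∞ :=
  condLExp_lt_top_of_le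
    (.of_forall fun _ => enorm_le_iff_norm_le.2 (Complex.abs_re_le_norm _)) hf.2

theorem Conditionable.condLExp_im_lt_top {f : X → ℂ} (hf : Conditionable 𝓐 μ f) :
    ∀ᵐ x ∂μ, condLExp 𝓐 μ (fun y => ‖(f y).im‖ₑ) x < ∞ :=
  condLExp_lt_top_of_le
    (.of_forall fun _ => enorm_le_iff_norm_le.2 (Complex.abs_im_le_norm _)) hf.2

theorem Conditionable.conj {f : X → ℂ} (hf : Conditionable 𝓐 μ f) :
    Conditionable 𝓐 μ fun x => conj (f x) :=
  ⟨Complex.continuous_conj.comp_aestronglyMeasurable hf.1, by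
    simpa only [RCLike.enorm_conj] using hf.2⟩

theorem Conditionable.neg {f : X → ℂ} (hf : Conditionable 𝓐 μ f) :
    Conditionable 𝓐 μ fun x => -f x :=
  ⟨hf.1.neg, by simpa only [enorm_neg] using hf.2⟩

theorem Conditionable.mul_left (h𝓐 : 𝓐 ≤ 𝓕) [SigmaFinite (μ.trim h𝓐)] {φ f : X → ℂ}
    (hφ : Measurable[𝓐] φ) (hf : Conditionable 𝓐 μ f) :
    Conditionable 𝓐 μ fun x => φ x * f x := by
  refine ⟨(hφ.mono h𝓐 le_rfl).aestronglyMeasurable.mul hf.1, ?_⟩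
  simp only [enorm_mul]
  filter_upwards [condLExp_mul_left h𝓐 (measurable_enorm.comp hφ) hf.1.enorm, hf.2] with x hx hfx
  exact hx.trans_lt (ENNReal.mul_lt_top enorm_lt_top hfx)

theorem condE_add {f g : X → ℂ} (hf : Conditionable 𝓐 μ f) (hg : Conditionable 𝓐 μ g) :
    condE 𝓐 μ (fun x => f x + g x) =ᵐ[μ] fun x => condE 𝓐 μ f x + condE 𝓐 μ g x := by
  filter_upwards [
    condReal_add (f := fun x => (f x).re) (g := fun x => (g x).re)
      (Complex.measurable_re.comp_aemeasurable hf.1.aemeasurable)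
      (Complex.measurable_re.comp_aemeasurable hg.1.aemeasurable)
      hf.condLExp_re_lt_top hg.condLExp_re_lt_top,
    condReal_add (f := fun x => (f x).im) (g := fun x => (g x).im)
      (Complex.measurable_im.comp_aemeasurable hf.1.aemeasurable)
      (Complex.measurable_im.comp_aemeasurable hg.1.aemeasurable)
      hf.condLExp_im_lt_top hg.condLExp_im_lt_top] with x hre him
  simp only [condE, Complex.add_re, Complex.add_im, hre, him, Complex.ofReal_add]
  ring

theorem condE_ofReal_mul_of_nonneg (h𝓐 : 𝓐 ≤ 𝓕) [SigmaFinite (μ.trim h𝓐)] {φ : X → ℝ} {f : X → ℂ}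
    (hφ : Measurable[𝓐] φ) (hφ0 : ∀ x, 0 ≤ φ x) (hf : AEStronglyMeasurable f μ) :
    condE 𝓐 μ (fun x => φ x * f x) =ᵐ[μ] fun x => φ x * condE 𝓐 μ f x := by
  filter_upwards [
    condReal_mul_of_nonneg (f := fun x => (f x).re) h𝓐 hφ hφ0
      (Complex.measurable_re.comp_aemeasurable hf.aemeasurable),
    condReal_mul_of_nonneg (f := fun x => (f x).im) h𝓐 hφ hφ0
      (Complex.measurable_im.comp_aemeasurable hf.aemeasurable)]
    with x hre him
  simp only [condE, Complex.re_ofReal_mul, Complex.im_ofReal_mul, hre, him, Complex.ofReal_mul]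
  ring

theorem condE_ofReal_mul (h𝓐 : 𝓐 ≤ 𝓕) [SigmaFinite (μ.trim h𝓐)] {φ : X → ℝ} {f : X → ℂ}
    (hφ : Measurable[𝓐] φ) (hf : Conditionable 𝓐 μ f) :
    condE 𝓐 μ (fun x => φ x * f x) =ᵐ[μ] fun x => φ x * condE 𝓐 μ f x := by
  have hpos : Measurable[𝓐] fun x => max (φ x) 0 := hφ.max measurable_const
  have hneg : Measurable[𝓐] fun x => max (-φ x) 0 := hφ.neg.max measurable_const
  have hsplit (x : X) (z : ℂ) :
      (φ x : ℂ) * z = (max (φ x) 0 : ℝ) * z + -((max (-φ x) 0 : ℝ) * z) := by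
    rw [← sub_eq_add_neg, ← sub_mul, ← Complex.ofReal_sub, max_zero_sub_max_neg_zero_eq_self]
  simp only [hsplit]
  filter_upwards [condE_ofReal_mul_of_nonneg h𝓐 hpos (fun _ => le_max_right _ _) hf.1,
    condE_ofReal_mul_of_nonneg h𝓐 hneg (fun _ => le_max_right _ _) hf.1,
    condE_add (hf.mul_left h𝓐 (Complex.measurable_ofReal.comp hpos))
      (hf.mul_left h𝓐 (Complex.measurable_ofReal.comp hneg)).neg] with x hpos hneg hadd
  simp only [Function.comp_apply] at hadd
  rw [hadd, condE_neg, hpos, hneg]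

theorem condE_mul_left (h𝓐 : 𝓐 ≤ 𝓕) [SigmaFinite (μ.trim h𝓐)] {φ f : X → ℂ}
    (hφ : Measurable[𝓐] φ) (hf : Conditionable 𝓐 μ f) :
    condE 𝓐 μ (fun x => φ x * f x) =ᵐ[μ] fun x => φ x * condE 𝓐 μ f x := by
  have hre : Measurable[𝓐] fun x => (φ x).re := Complex.measurable_re.comp hφ
  have him : Measurable[𝓐] fun x => (φ x).im := Complex.measurable_im.comp hφ
  have hsplit (x : X) (z : ℂ) : φ x * z = (φ x).re * z + Complex.I * ((φ x).im * z) := by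
    linear_combination (-z) * Complex.re_add_im (φ x)
  simp only [hsplit]
  filter_upwards [condE_ofReal_mul h𝓐 hre hf, condE_ofReal_mul h𝓐 him hf,
    condE_add (hf.mul_left h𝓐 (Complex.measurable_ofReal.comp hre))
      ((hf.mul_left h𝓐 (Complex.measurable_ofReal.comp him)).mul_left h𝓐
        (measurable_const (a := Complex.I)))] with x hre him hadd
  simp only [Function.comp_apply] at hadd
  rw [hadd, condE_I_mul, hre, him]

theorem condE_ae_eq_condExp {f : X → ℂ} (hf : Integrable f μ) : condE 𝓐 μ f =ᵐ[μ] μ[f|𝓐] := by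
  filter_upwards [condReal_ae_eq_condExp (𝓐 := 𝓐) hf.re, condReal_ae_eq_condExp (𝓐 := 𝓐) hf.im,
    Complex.reCLM.comp_condExp_comm (m := 𝓐) hf, Complex.imCLM.comp_condExp_comm (m := 𝓐) hf]
    with x hre him hre' him'
  refine Complex.ext ?_ ?_
  · simpa [condE] using hre.trans hre'.symm
  · simpa [condE] using him.trans him'.symm

theorem integral_condE (h𝓐 : 𝓐 ≤ 𝓕) [SigmaFinite (μ.trim h𝓐)] {f : X → ℂ}
    (hf : Integrable f μ) : ∫ x, condE 𝓐 μ f x ∂μ = ∫ x, f x ∂μ :=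
  (integral_congr_ae (condE_ae_eq_condExp hf)).trans (integral_condExp h𝓐)

theorem integral_mul_condE (h𝓐 : 𝓐 ≤ 𝓕) [SigmaFinite (μ.trim h𝓐)] {φ f : X → ℂ}
    (hφ : Measurable[𝓐] φ) (hf : Conditionable 𝓐 μ f) (hφf : Integrable (fun x => φ x * f x) μ) :
    ∫ x, φ x * condE 𝓐 μ f x ∂μ = ∫ x, φ x * f x ∂μ :=
  (integral_congr_ae (condE_mul_left h𝓐 hφ hf).symm).trans (integral_condE h𝓐 hφf)

theorem integral_conj_mul_condE_mul (h𝓐 : 𝓐 ≤ 𝓕) [SigmaFinite (μ.trim h𝓐)] {a f g : X → ℂ}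
    (ha : Measurable[𝓐] a) (hf : Conditionable 𝓐 μ f) (hg : Conditionable 𝓐 μ g)
    (hleft : Integrable (fun x => conj (a x * condE 𝓐 μ f x) * g x) μ)
    (hright : Integrable (fun x => conj (a x) * condE 𝓐 μ g x * conj (f x)) μ) :
    ∫ x, conj (a x * condE 𝓐 μ f x) * g x ∂μ =
      ∫ x, conj (a x) * condE 𝓐 μ g x * conj (f x) ∂μ := by
  have hconj {φ : X → ℂ} (hφ : Measurable[𝓐] φ) : Measurable[𝓐] fun x => conj (φ x) :=
    Complex.continuous_conj.measurable.comp hφ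
  calc ∫ x, conj (a x * condE 𝓐 μ f x) * g x ∂μ
      = ∫ x, conj (a x * condE 𝓐 μ f x) * condE 𝓐 μ g x ∂μ :=
        (integral_mul_condE h𝓐 (hconj (ha.mul (measurable_condE f))) hg hleft).symm
    _ = ∫ x, conj (a x) * condE 𝓐 μ g x * condE 𝓐 μ (fun y => conj (f y)) x ∂μ := by
        simp only [condE_conj]
        congr 1 with x
        rw [map_mul, mul_right_comm]
    _ = ∫ x, conj (a x) * condE 𝓐 μ g x * conj (f x) ∂μ :=
        integral_mul_condE h𝓐 ((hconj ha).mul (measurable_condE g)) hf.conj hright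

theorem Conditionable.mul_conj_self {u : X → ℂ} (hu : AEStronglyMeasurable u μ)
    (hu2 : ∀ᵐ x ∂μ, condSq 𝓐 μ u x < ∞) : Conditionable 𝓐 μ fun x => u x * conj (u x) := by
  refine ⟨hu.mul (Complex.continuous_conj.comp_aestronglyMeasurable hu), ?_⟩
  simpa only [enorm_mul, RCLike.enorm_conj, ← sq, condSq] using hu2

theorem measurable_mul_condSq {a u : X → ℂ} (ha : Measurable[𝓐] a) :
    Measurable[𝓐] fun x => a x * ((condSq 𝓐 μ u x).toReal : ℂ) :=
  ha.mul (Complex.measurable_ofReal.comp (measurable_condLExp 𝓐 μ _).ennreal_toReal)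

theorem condE_mul_conj_self (u : X → ℂ) (x : X) :
    condE 𝓐 μ (fun x => u x * conj (u x)) x = (condSq 𝓐 μ u x).toReal := by
  have hneg : (fun y => ENNReal.ofReal (-‖u y‖ ^ 2)) = 0 := by
    ext y
    simp
  simp only [RCLike.mul_conj, ← Complex.ofReal_pow, Complex.coe_algebraMap, condE_ofReal]
  simp [condReal, hneg, condSq]

end ConditionalExpectation

end WCE

namespace SpectralRadiusAlgebra

theorem commute_star_pow_mul_pow {A : Type*} [Monoid A] [StarMul A] {S N T : A}
    (hS : SemiconjBy T S N) (hS' : SemiconjBy T (star S) (star N)) (hN : Commute N T)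
    (hN' : Commute (star N) T) (n : ℕ) : Commute S (star T ^ n * T ^ n) := by
  cases n with
  | zero => simp
  | succ n =>
    have hpow : SemiconjBy (T ^ (n + 1)) S N := by
      rw [pow_succ]
      exact SemiconjBy.mul_left (hN.pow_right n).symm hS
    have hstar : SemiconjBy (star T) N S := by
      simpa only [star_star] using hS'.star_star_star
    have hcomm : Commute (star T) N := by
      simpa only [star_star] using hN'.symm.star_star
    have hpow_star : SemiconjBy (star T ^ (n + 1)) N S := by
      rw [pow_succ']
      exact hstar.mul_left (hcomm.pow_left n)
    exact (hpow_star.mul_left hpow).symm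

variable {H : Type*} [NormedAddCommGroup H] [InnerProductSpace ℂ H] [CompleteSpace H]

theorem mem_spectralRadiusAlgebra_of_commute {S T : H →L[ℂ] H}
    (h : ∀ n : ℕ, Commute S (ContinuousLinearMap.adjoint T ^ n * T ^ n)) :
    S ∈ spectralRadiusAlgebra T := by
  refine ⟨‖S‖, ?_⟩
  rintro _ ⟨m, -, rfl⟩
  have hR : Commute (R T m) S :=
    Commute.cfcₙ_nnreal (Commute.tsum_right S fun n => (h n).smul_right _).symm _
  simp only [hR.eq, mul_assoc]
  by_cases hunit : IsUnit (R T m)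
  · rw [Ring.mul_inverse_cancel _ hunit, mul_one]
  · simp [Ring.inverse_non_unit _ hunit]

end SpectralRadiusAlgebra

namespace WCE

section MultiplicationOperators

variable {X : Type*} {𝓕 : MeasurableSpace X} {μ : Measure X}

/-- The multiplication operator `M_φ` on `L²` of an essentially bounded function `φ`. -/
noncomputable def mulOp (φ : X → ℂ) (hφ : MemLp φ ∞ μ) : Lp ℂ 2 μ →L[ℂ] Lp ℂ 2 μ :=
  (ContinuousLinearMap.mul ℂ ℂ).holderL μ ∞ 2 2 (hφ.toLp φ)

theorem mulOp_apply_ae {φ : X → ℂ} (hφ : MemLp φ ∞ μ) (f : Lp ℂ 2 μ) :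
    mulOp φ hφ f =ᵐ[μ] fun x => φ x * f x := by
  filter_upwards [(ContinuousLinearMap.mul ℂ ℂ).coeFn_holder (r := 2) (hφ.toLp φ) f,
    hφ.coeFn_toLp] with x hholder hcoe
  exact hholder.trans (congrArg (· * f x) hcoe)

theorem adjoint_mulOp {φ : X → ℂ} (hφ : MemLp φ ∞ μ) :
    ContinuousLinearMap.adjoint (mulOp φ hφ) = mulOp (star φ) hφ.star := by
  refine Eq.symm <| (ContinuousLinearMap.eq_adjoint_iff _ _).2 fun f g => ?_
  rw [L2.inner_def, L2.inner_def]
  refine integral_congr_ae ?_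
  filter_upwards [mulOp_apply_ae hφ.star f, mulOp_apply_ae hφ g] with x hf hg
  simp only [RCLike.inner_apply, hf, hg, Pi.star_apply, RCLike.star_def, map_mul, Complex.conj_conj]
  ring

theorem enorm_ofReal_toReal {c : ℝ≥0∞} (hc : c ≠ ∞) : ‖(c.toReal : ℂ)‖ₑ = c := by
  rw [← ofReal_norm, Complex.norm_of_nonneg ENNReal.toReal_nonneg, ENNReal.ofReal_toReal hc]

theorem eLpNorm_two_sq_eq_lintegral {E : Type*} [NormedAddCommGroup E] (f : X → E) :
    eLpNorm f 2 μ ^ 2 = ∫⁻ x, ‖f x‖ₑ ^ 2 ∂μ := by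
  simpa using eLpNorm_nnreal_pow_eq_lintegral (f := f) (μ := μ) (p := 2) two_ne_zero

end MultiplicationOperators

namespace IsWCE

variable {X : Type*} {𝓐 𝓕 : MeasurableSpace X} {μ : @Measure X 𝓕} {w u : X → ℂ}
  {T : Lp ℂ 2 μ →L[ℂ] Lp ℂ 2 μ}

theorem congr_left {w' : X → ℂ} (hT : IsWCE 𝓐 μ w u T) (hw : w =ᵐ[μ] w') : IsWCE 𝓐 μ w' u T := by
  refine fun f => ⟨(hT f).1, ?_⟩
  filter_upwards [(hT f).2, hw] with x hTf hwx
  rw [hTf, hwx]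

variable {a : X → ℂ} {S : Lp ℂ 2 μ →L[ℂ] Lp ℂ 2 μ}

theorem commute_mulOp (h𝓐 : 𝓐 ≤ 𝓕) [SigmaFinite (μ.trim h𝓐)] (hT : IsWCE 𝓐 μ w u T)
    {φ : X → ℂ} (hφ : MemLp φ ∞ μ) (hφm : Measurable[𝓐] φ) : Commute (mulOp φ hφ) T := by
  refine ContinuousLinearMap.ext fun f => Lp.ext ?_
  have hswap : (fun x => u x * mulOp φ hφ f x) =ᵐ[μ] fun x => φ x * (u x * f x) := by
    filter_upwards [mulOp_apply_ae hφ f] with x hx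
    rw [hx]
    ring
  filter_upwards [mulOp_apply_ae hφ (T f), (hT f).2, (hT (mulOp φ hφ f)).2, condE_congr hswap,
    condE_mul_left h𝓐 hφm (hT f).1] with x hmul hTf hTmul hcongr hpull
  rw [mul_apply_eq_comp, mul_apply_eq_comp, hmul, hTf, hTmul, hcongr, hpull]
  ring

theorem apply_mul_conj_ae (h𝓐 : 𝓐 ≤ 𝓕) [SigmaFinite (μ.trim h𝓐)]
    (hu : AEStronglyMeasurable u μ) (hu2 : ∀ᵐ x ∂μ, condSq 𝓐 μ u x < ∞) (hT : IsWCE 𝓐 μ w u T)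
    {φ : X → ℂ} (hφ : Measurable[𝓐] φ) {f : Lp ℂ 2 μ} (hf : f =ᵐ[μ] fun x => φ x * conj (u x)) :
    T f =ᵐ[μ] fun x => w x * (φ x * (condSq 𝓐 μ u x).toReal) := by
  have hmul : (fun x => u x * f x) =ᵐ[μ] fun x => φ x * (u x * conj (u x)) := by
    filter_upwards [hf] with x hx
    rw [hx]
    ring
  filter_upwards [(hT f).2, condE_congr hmul,
    condE_mul_left h𝓐 hφ (Conditionable.mul_conj_self hu hu2)] with x hTf hcongr hpull
  rw [hTf, hcongr, hpull, condE_mul_conj_self]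

theorem semiconjBy_mulOp (h𝓐 : 𝓐 ≤ 𝓕) [SigmaFinite (μ.trim h𝓐)]
    (hu : AEStronglyMeasurable u μ) (hu2 : ∀ᵐ x ∂μ, condSq 𝓐 μ u x < ∞) (hT : IsWCE 𝓐 μ w u T)
    (ha : Measurable[𝓐] a) (hS : IsWCE 𝓐 μ (fun x => a x * conj (u x)) u S) {φ : X → ℂ}
    (hφ : MemLp φ ∞ μ) (hφa : ∀ x, φ x = a x * (condSq 𝓐 μ u x).toReal) :
    SemiconjBy T S (mulOp φ hφ) := by
  refine ContinuousLinearMap.ext fun f => Lp.ext ?_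
  have hSf : S f =ᵐ[μ] fun x => a x * condE 𝓐 μ (fun y => u y * f y) x * conj (u x) := by
    filter_upwards [(hS f).2] with x hx
    rw [hx]
    ring
  filter_upwards [hT.apply_mul_conj_ae h𝓐 hu hu2 (ha.mul (measurable_condE _)) hSf, (hT f).2,
    mulOp_apply_ae hφ (T f)] with x hTS hTf hmul
  rw [mul_apply_eq_comp, mul_apply_eq_comp, hTS, hmul, hTf, hφa, Pi.mul_apply]
  ring

theorem adjoint (h𝓐 : 𝓐 ≤ 𝓕) [SigmaFinite (μ.trim h𝓐)] (hu : AEStronglyMeasurable u μ)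
    (ha : Measurable[𝓐] a) (hS : IsWCE 𝓐 μ (fun x => a x * conj (u x)) u S) :
    IsWCE 𝓐 μ (fun x => conj (a x) * conj (u x)) u (ContinuousLinearMap.adjoint S) := by
  refine fun g => ⟨(hS g).1, ?_⟩
  have hconj : Measurable[𝓐] fun x => conj (a x) := Complex.continuous_conj.measurable.comp ha
  have hmem : MemLp (fun x => conj (a x) * conj (u x) * condE 𝓐 μ (fun y => u y * g y) x) 2 μ := by
    refine (Lp.memLp (S g)).congr_norm ?_ ?_
    · exact ((hconj.mono h𝓐 le_rfl).aestronglyMeasurable.mul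
        (Complex.continuous_conj.comp_aestronglyMeasurable hu)).mul
          ((measurable_condE _).mono h𝓐 le_rfl).aestronglyMeasurable
    · filter_upwards [(hS g).2] with x hx
      simp only [hx, norm_mul, RCLike.norm_conj]
  suffices h : ContinuousLinearMap.adjoint S g = hmem.toLp from h ▸ hmem.coeFn_toLp
  refine ext_inner_left ℂ fun f => ?_
  rw [ContinuousLinearMap.adjoint_inner_right]
  have hleft : (fun x => inner ℂ (S f x) (g x)) =ᵐ[μ] fun x =>
      conj (a x * condE 𝓐 μ (fun y => u y * f y) x) * (u x * g x) := by
    filter_upwards [(hS f).2] with x hx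
    simp only [RCLike.inner_apply, hx, map_mul, Complex.conj_conj]
    ring
  have hright : (fun x => inner ℂ (f x) (hmem.toLp _ x)) =ᵐ[μ] fun x =>
      conj (a x) * condE 𝓐 μ (fun y => u y * g y) x * conj (u x * f x) := by
    filter_upwards [hmem.coeFn_toLp] with x hx
    simp only [RCLike.inner_apply, hx, map_mul]
    ring
  rw [L2.inner_def, L2.inner_def, integral_congr_ae hleft, integral_congr_ae hright]
  exact integral_conj_mul_condE_mul h𝓐 ha (hS f).1 (hS g).1
    ((L2.integrable_inner (S f) g).congr hleft)
    ((L2.integrable_inner f (hmem.toLp _)).congr hright)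

theorem setLIntegral_sq_mul_condSq_le (h𝓐 : 𝓐 ≤ 𝓕) [SigmaFinite (μ.trim h𝓐)]
    (hu : AEStronglyMeasurable u μ) (hu2 : ∀ᵐ x ∂μ, condSq 𝓐 μ u x < ∞)
    (hS : IsWCE 𝓐 μ (fun x => a x * conj (u x)) u S) {B : Set X} (hB : MeasurableSet[𝓐] B)
    (hfin : ∫⁻ x in B, ‖u x‖ₑ ^ 2 ∂μ ≠ ∞) :
    ∫⁻ x in B, (‖a x‖ₑ * condSq 𝓐 μ u x) ^ 2 * ‖u x‖ₑ ^ 2 ∂μ ≤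
      ‖S‖ₑ ^ 2 * ∫⁻ x in B, ‖u x‖ₑ ^ 2 ∂μ := by
  let g : X → ℂ := fun x => B.indicator 1 x * conj (u x)
  have hone : Measurable[𝓐] (B.indicator (1 : X → ℂ)) :=
    (@measurable_one ℂ X _ 𝓐 _).indicator hB
  have hnorm : eLpNorm g 2 μ ^ 2 = ∫⁻ x in B, ‖u x‖ₑ ^ 2 ∂μ := by
    rw [eLpNorm_two_sq_eq_lintegral, ← lintegral_indicator (h𝓐 B hB)]
    refine lintegral_congr fun x => ?_
    by_cases hx : x ∈ B <;> simp [g, hx]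
  have hmem : MemLp g 2 μ :=
    ⟨(hone.mono h𝓐 le_rfl).aestronglyMeasurable.mul
      (Complex.continuous_conj.comp_aestronglyMeasurable hu),
      (ENNReal.pow_lt_top_iff.1 (hnorm ▸ hfin.lt_top)).resolve_right two_ne_zero⟩
  calc ∫⁻ x in B, (‖a x‖ₑ * condSq 𝓐 μ u x) ^ 2 * ‖u x‖ₑ ^ 2 ∂μ
      = ‖S (hmem.toLp g)‖ₑ ^ 2 := by
        rw [Lp.enorm_def, eLpNorm_two_sq_eq_lintegral, ← lintegral_indicator (h𝓐 B hB)]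
        refine lintegral_congr_ae ?_
        filter_upwards [hS.apply_mul_conj_ae h𝓐 hu hu2 hone hmem.coeFn_toLp, hu2] with x hx hfx
        rw [hx]
        by_cases hxB : x ∈ B
        · simp only [Set.indicator_of_mem hxB, Pi.one_apply, one_mul, enorm_mul,
            enorm_ofReal_toReal hfx.ne, RCLike.enorm_conj]
          ring
        · simp [hxB]
    _ ≤ (‖S‖ₑ * ‖hmem.toLp g‖ₑ) ^ 2 := by gcongr; exact S.le_opENorm _
    _ = ‖S‖ₑ ^ 2 * ∫⁻ x in B, ‖u x‖ₑ ^ 2 ∂μ := by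
        rw [mul_pow, Lp.enorm_toLp, hnorm]

theorem ae_enorm_mul_condSq_le (h𝓐 : 𝓐 ≤ 𝓕) [SigmaFinite (μ.trim h𝓐)]
    (hu : AEStronglyMeasurable u μ) (hu2 : ∀ᵐ x ∂μ, condSq 𝓐 μ u x < ∞) (ha : Measurable[𝓐] a)
    (hS : IsWCE 𝓐 μ (fun x => a x * conj (u x)) u S) :
    ∀ᵐ x ∂μ, ‖a x‖ₑ * condSq 𝓐 μ u x ≤ ‖S‖ₑ := by
  have hE : Measurable[𝓐] (condSq 𝓐 μ u) := measurable_condLExp 𝓐 μ _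
  have hψ : Measurable[𝓐] fun x => (‖a x‖ₑ * condSq 𝓐 μ u x) ^ 2 :=
    ((measurable_enorm.comp ha).mul hE).pow_const 2
  have hEtrim : ∀ᵐ x ∂μ.trim h𝓐, condSq 𝓐 μ u x ≠ ∞ :=
    (trim_measurableSet_eq h𝓐 (hE (measurableSet_singleton ∞).compl).compl).trans
      (hu2.mono fun _ hx => hx.ne)
  let ν : @Measure X 𝓐 := (μ.trim h𝓐).withDensity (condSq 𝓐 μ u)
  have hν_eq : (μ.withDensity fun x => ‖u x‖ₑ ^ 2).trim h𝓐 = ν :=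
    trim_withDensity_eq_withDensity_condLExp h𝓐 _
  have : SigmaFinite ν := SigmaFinite.withDensity_of_ne_top hEtrim
  have hν {ψ : X → ℝ≥0∞} (hψ : Measurable[𝓐] ψ) {B : Set X} (hB : MeasurableSet[𝓐] B) :
      ∫⁻ x in B, ψ x ∂ν = ∫⁻ x in B, ψ x * ‖u x‖ₑ ^ 2 ∂μ := by
    rw [← hν_eq, setLIntegral_trim h𝓐 hψ hB, setLIntegral_withDensity_eq_lintegral_mul₀
      (hu.enorm.pow_const 2) (hψ.mono h𝓐 le_rfl).aemeasurable (h𝓐 B hB)]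
    simp only [Pi.mul_apply, mul_comm]
  have hν_apply {B : Set X} (hB : MeasurableSet[𝓐] B) : ν B = ∫⁻ x in B, ‖u x‖ₑ ^ 2 ∂μ := by
    simpa only [setLIntegral_one, one_mul] using hν measurable_const (ψ := fun _ => 1) hB
  have hle : (fun x => (‖a x‖ₑ * condSq 𝓐 μ u x) ^ 2) ≤ᵐ[ν] fun _ => ‖S‖ₑ ^ 2 := by
    refine ae_le_of_forall_setLIntegral_le_of_sigmaFinite hψ fun B hB hνB => ?_
    rw [hν hψ hB, setLIntegral_const, hν_apply hB]
    exact hS.setLIntegral_sq_mul_condSq_le h𝓐 hu hu2 hB (hν_apply hB ▸ hνB.ne)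
  filter_upwards [ae_of_ae_trim h𝓐 ((ae_withDensity_iff hE).1 hle)] with x hx
  rcases eq_or_ne (condSq 𝓐 μ u x) 0 with h0 | h0
  · simp [h0]
  · exact (ENNReal.pow_le_pow_left_iff two_ne_zero).1 (hx h0)

theorem memLp_top_mul_condSq (h𝓐 : 𝓐 ≤ 𝓕) [SigmaFinite (μ.trim h𝓐)]
    (hu : AEStronglyMeasurable u μ) (hu2 : ∀ᵐ x ∂μ, condSq 𝓐 μ u x < ∞) (ha : Measurable[𝓐] a)
    (hS : IsWCE 𝓐 μ (fun x => a x * conj (u x)) u S) :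
    MemLp (fun x => a x * ((condSq 𝓐 μ u x).toReal : ℂ)) ∞ μ := by
  refine memLp_top_of_bound_enorm ?_ ‖S‖₊ ?_
  · exact ((measurable_mul_condSq ha).mono h𝓐 le_rfl).aestronglyMeasurable
  · filter_upwards [hS.ae_enorm_mul_condSq_le h𝓐 hu hu2 ha, hu2] with x hx hfx
    rwa [enorm_mul, enorm_ofReal_toReal hfx.ne]

theorem commute_adjoint_pow_mul_pow (h𝓐 : 𝓐 ≤ 𝓕) [SigmaFinite (μ.trim h𝓐)]
    (hu : AEStronglyMeasurable u μ) (hu2 : ∀ᵐ x ∂μ, condSq 𝓐 μ u x < ∞) (hT : IsWCE 𝓐 μ w u T)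
    (ha : Measurable[𝓐] a) (hS : IsWCE 𝓐 μ (fun x => a x * conj (u x)) u S) (n : ℕ) :
    Commute S (ContinuousLinearMap.adjoint T ^ n * T ^ n) := by
  have hN : MemLp (fun x => a x * ((condSq 𝓐 μ u x).toReal : ℂ)) ∞ μ :=
    hS.memLp_top_mul_condSq h𝓐 hu hu2 ha
  have hNm : Measurable[𝓐] fun x => a x * ((condSq 𝓐 μ u x).toReal : ℂ) :=
    measurable_mul_condSq ha
  have hconj {φ : X → ℂ} (hφ : Measurable[𝓐] φ) : Measurable[𝓐] fun x => conj (φ x) :=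
    Complex.continuous_conj.measurable.comp hφ
  refine SpectralRadiusAlgebra.commute_star_pow_mul_pow (N := mulOp _ hN)
    (hT.semiconjBy_mulOp h𝓐 hu hu2 ha hS hN fun _ => rfl) ?_ (hT.commute_mulOp h𝓐 hN hNm) ?_ n
  · rw [ContinuousLinearMap.star_eq_adjoint, ContinuousLinearMap.star_eq_adjoint, adjoint_mulOp]
    exact hT.semiconjBy_mulOp h𝓐 hu hu2 (hconj ha) (hS.adjoint h𝓐 hu ha) hN.star fun x => by simp
  · rw [ContinuousLinearMap.star_eq_adjoint, adjoint_mulOp]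
    exact hT.commute_mulOp h𝓐 hN.star (hconj hNm)

end IsWCE

end WCE

theorem proposition2p4_general {X : Type*} {𝓐 𝓕 : MeasurableSpace X} (h𝓐 : 𝓐 ≤ 𝓕)
    {μ : @Measure X 𝓕} [SigmaFinite (μ.trim h𝓐)] {w u : X → ℂ} (hu : AEStronglyMeasurable u μ)
    (hu2 : ∀ᵐ x ∂μ, WCE.condSq 𝓐 μ u x < ∞)
    {T : Lp ℂ 2 μ →L[ℂ] Lp ℂ 2 μ} (hT : WCE.IsWCE 𝓐 μ w u T)
    {a : X → ℂ} (ha : AEStronglyMeasurable[𝓐] a μ)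
    {S : Lp ℂ 2 μ →L[ℂ] Lp ℂ 2 μ} (hS : WCE.IsWCE 𝓐 μ (fun x => a x * conj (u x)) u S) :
    S ∈ SpectralRadiusAlgebra.spectralRadiusAlgebra T := by
  obtain ⟨b, hb, hab⟩ := ha
  have hS' : WCE.IsWCE 𝓐 μ (fun x => b x * conj (u x)) u S :=
    hS.congr_left (hab.mul (ae_eq_refl fun x => conj (u x)))
  exact SpectralRadiusAlgebra.mem_spectralRadiusAlgebra_of_commute fun n =>
    hT.commute_adjoint_pow_mul_pow h𝓐 hu hu2 hb.measurable hS' n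

theorem proposition2p4 {X : Type*} {𝓐 𝓕 : MeasurableSpace X} (h𝓐 : 𝓐 ≤ 𝓕)
    (μ : @MeasureTheory.Measure X 𝓕) [MeasureTheory.SigmaFinite μ]
    [MeasureTheory.SigmaFinite (μ.trim h𝓐)]
    (w u : X → ℂ) (hw : WCE.Conditionable 𝓐 μ w) (hu : WCE.Conditionable 𝓐 μ u)
    (hu2 : ∃ C : ℝ≥0, ∀ᵐ x ∂μ, WCE.condSq 𝓐 μ u x ≤ C)
    (T : Lp ℂ 2 μ →L[ℂ] Lp ℂ 2 μ) (hT : WCE.IsWCE 𝓐 μ w u T)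
    (a : X → ℝ) (ha : AEStronglyMeasurable[𝓐] a μ) (ha0 : ∀ᵐ x ∂μ, 0 ≤ a x)
    (S : Lp ℂ 2 μ →L[ℂ] Lp ℂ 2 μ)
    (hS : WCE.IsWCE 𝓐 μ (fun x => (a x : ℂ) * conj (u x)) u S) :
    S ∈ SpectralRadiusAlgebra.spectralRadiusAlgebra T := by
  obtain ⟨C, hC⟩ := hu2
  exact proposition2p4_general h𝓐 hu.1 (hC.mono fun _ hx => hx.trans_lt ENNReal.coe_lt_top) hT
    (Complex.continuous_ofReal.comp_aestronglyMeasurable ha) hS
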